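/- All graphs are finite and simple. Let $H$ and $G$ be graphs with $V(H)\subseteq V(G)$ (the edges of $H$ need not be edges of $G$). An \emph{$H$-scheme} in $G$ is a collection of paths $\{P_{uv}: uv\in E(H)\}$ such that (1) each $P_{uv}$ is a $u,v$-path in $G$ with $V(P_{uv})\cap V(H)=\{u,v\}$, and (2) whenever $e_1,\dots,e_k\in E(H)$ ($k\ge 1$) satisfy $V(P_{e_1})\cap\dots\cap V(P_{e_k})\ne\emptyset$, some vertex of $H$ is incident with all of $e_1,\dots,e_k$. The graph $G$ has a \emph{rooted $H$-minor} if there are pairwise vertex-disjoint connected subgraphs $C_v$ of $G$ ($v\in V(H)$) with $v\in V(C_v)$ such that for each edge $uv$ of $H$ there is an edge of $G$ between $C_u$ and $C_v$. The graph $H$ is \emph{contractible} if every graph $G$ that contains an $H$-scheme has a rooted $H$-minor. For a graph $H$, let $M'(H)$ be the graph with two vertices $v_1,v_2$ for every $v\in V(H)$, in which $u_i$ is adjacent to $v_j$ if and only if $uv\in E(H)$ and $i=2$ or $j=2$ (or both). The graph $H$ is \emph{$M'$-contractible} if $M'(H)$ has a rooted $H$-minor, where $v_1$ is the root corresponding to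 $v\in V(H)$. \textbf{Corollary.} The complete graph $K_7$ is $M'$-contractible, but it is not contractible. -/

import Mathlib

universe u

/-- An `H`-scheme in `G`. The inclusion `V(H) ⊆ V(G)` is given by the injection `r`; the
scheme-path of the (unordered) edge `uv` is a path `path u v _` from `r u` to `r v` in `G`, and
traversing the edge the other way gives the same path, reversed. -/
structure HScheme {V W : Type u} (H : SimpleGraph V) (G : SimpleGraph W) (r : V ↪ W) where
  path : ∀ u v : V, H.Adj u v → G.Walk (r u) (r v)
  path_symm : ∀ (u v : V) (h : H.Adj u v), path v u h.symm = (path u v h).reverse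
  isPath : ∀ (u v : V) (h : H.Adj u v), (path u v h).IsPath
  /-- The only vertices of `H` on the scheme-path of `uv` are `u` and `v`. -/
  inter_eq : ∀ (u v : V) (h : H.Adj u v),
    {w : W | w ∈ (path u v h).support} ∩ Set.range r = {r u, r v}
  /-- Edges of `H` whose scheme-paths all contain a common vertex have a common endpoint. -/
  common_endpoint : ∀ S : Finset (Sym2 V), S.Nonempty → (S : Set (Sym2 V)) ⊆ H.edgeSet →
    (∃ w : W, ∀ (u v : V) (h : H.Adj u v), s(u, v) ∈ S → w ∈ (path u v h).support) →
    ∃ x : V, ∀ e ∈ S, x ∈ e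

/-- `G` has a rooted `H`-minor, where `r v` is the root of the vertex `v` of `H`: there are
vertex-disjoint connected subgraphs `C v` of `G` with `r v` in `C v`, such that `G` has an edge
between `C u` and `C v` for each edge `uv` of `H`. -/
def HasRootedMinor {V W : Type u} (H : SimpleGraph V) (G : SimpleGraph W) (r : V ↪ W) : Prop :=
  ∃ C : V → G.Subgraph,
    (∀ v, (C v).Connected) ∧
    (∀ u v, u ≠ v → Disjoint (C u).verts (C v).verts) ∧
    (∀ v, r v ∈ (C v).verts) ∧
    (∀ u v, H.Adj u v → ∃ x ∈ (C u).verts, ∃ y ∈ (C v).verts, G.Adj x y)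

/-- A finite graph `H` is contractible if every finite graph `G` that contains an `H`-scheme has
a rooted `H`-minor. -/
def IsContractible {V : Type u} [Finite V] (H : SimpleGraph V) : Prop :=
  ∀ (W : Type u) [Finite W] (G : SimpleGraph W) (r : V ↪ W),
    Nonempty (HScheme H G r) → HasRootedMinor H G r

/-- The graph `M'(H)`: the vertices are `v₁ = (v, 0)` and `v₂ = (v, 1)` for the vertices `v`
of `H`, and `uᵢ`, `vⱼ` are adjacent when `u`, `v` are adjacent in `H` and `i = 2` or `j = 2`. -/
def mPrime {V : Type u} (H : SimpleGraph V) : SimpleGraph (V × Fin 2) where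
  Adj a b := H.Adj a.1 b.1 ∧ (a.2 = 1 ∨ b.2 = 1)
  symm := ⟨fun _ _ h => ⟨h.1.symm, h.2.symm⟩⟩
  loopless := ⟨fun _ h => H.irrefl h.1⟩

/-- The root `v₁` of `M'(H)` that corresponds to the vertex `v` of `H`. -/
def mPrimeRoot (V : Type u) : V ↪ V × Fin 2 :=
  ⟨fun v => (v, 0), fun _ _ h => congrArg Prod.fst h⟩

/-- `H` is `M'`-contractible if `M'(H)` has a rooted `H`-minor with roots `v₁`. -/
def IsMPrimeContractible {V : Type u} (H : SimpleGraph V) : Prop :=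
  HasRootedMinor H (mPrime H) (mPrimeRoot V)

open SimpleGraph

/-! ### The complete graph is `M'`-contractible -/

/-! For the positive half, the bag of `v` is the edge from `v₁` to `(v + 1)₂`; any two bags are
joined through their second vertices. For the negative half, `mPrimeFill H` has a scheme of the
complete graph for every `H`: each vertex of the path of `uv` projects to `u` or `v`, so a vertex
common to several paths projects to a common endpoint. A bag contains no root but its own, so the
added root edges only join bags of pairs that are non-adjacent in `H`. Hence a rooted complete minor
exists exactly when `H` is `M'`-contractible. A theta graph on seven vertices is not, by the
verified search `refuteMinor_theta`. -/

theorem isMPrimeContractible_completeGraph_fin_seven :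
    IsMPrimeContractible (completeGraph (Fin 7)) := by
  have hadj : ∀ v : Fin 7, (mPrime (completeGraph (Fin 7))).Adj (v, 0) (v + 1, 1) := by
    intro v
    refine ⟨?_, Or.inr rfl⟩
    revert v
    simp only [top_adj]
    decide
  refine ⟨fun v => subgraphOfAdj _ (hadj v), fun v => Subgraph.subgraphOfAdj_connected (hadj v),
    ?_, ?_, ?_⟩
  · intro u v huv
    simp [subgraphOfAdj, huv.symm]
  · intro v
    exact Or.inl rfl
  · intro u v huv
    refine ⟨(u + 1, 1), by simp [subgraphOfAdj], (v + 1, 1), by simp [subgraphOfAdj], ?_,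
      Or.inl rfl⟩
    simpa using huv

/-! ### A scheme of the complete graph from a subgraph -/

/-- The graph `M'(H)`, in which moreover the roots of any two distinct non-adjacent vertices
of `H` are adjacent. -/
def mPrimeFill {V : Type u} (H : SimpleGraph V) : SimpleGraph (V × Fin 2) where
  Adj a b := a.1 ≠ b.1 ∧
    ((H.Adj a.1 b.1 ∧ (a.2 = 1 ∨ b.2 = 1)) ∨ (¬ H.Adj a.1 b.1 ∧ a.2 = 0 ∧ b.2 = 0))
  symm := ⟨fun _ _ h => ⟨h.1.symm, h.2.imp (fun k => ⟨k.1.symm, k.2.symm⟩)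
    (fun k => ⟨fun l => k.1 l.symm, k.2.2, k.2.1⟩)⟩⟩
  loopless := ⟨fun _ h => h.1 rfl⟩

instance {V : Type u} [DecidableEq V] (H : SimpleGraph V) [DecidableRel H.Adj] :
    DecidableRel (mPrimeFill H).Adj := fun _ _ => by
  unfold mPrimeFill
  infer_instance

/-- The path from `u₁` to `v₁`: an edge if `uv` is not an edge of `H`, and `u₁ v₂ u₂ v₁`
otherwise. -/
def mPrimeFillPath {V : Type u} (H : SimpleGraph V) [DecidableRel H.Adj] (u v : V) (h : u ≠ v) :
    (mPrimeFill H).Walk (u, 0) (v, 0) :=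
  if hH : H.Adj u v then
    have h₁ : (mPrimeFill H).Adj (u, 0) (v, 1) := ⟨h, Or.inl ⟨hH, Or.inr rfl⟩⟩
    have h₂ : (mPrimeFill H).Adj (v, 1) (u, 1) := ⟨h.symm, Or.inl ⟨hH.symm, Or.inl rfl⟩⟩
    have h₃ : (mPrimeFill H).Adj (u, 1) (v, 0) := ⟨h, Or.inl ⟨hH, Or.inl rfl⟩⟩
    Walk.cons h₁ (Walk.cons h₂ (Walk.cons h₃ Walk.nil))
  else
    have h₁ : (mPrimeFill H).Adj (u, 0) (v, 0) := ⟨h, Or.inr ⟨hH, rfl, rfl⟩⟩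
    Walk.cons h₁ Walk.nil

theorem support_mPrimeFillPath {V : Type u} (H : SimpleGraph V) [DecidableRel H.Adj] (u v : V)
    (h : u ≠ v) : (mPrimeFillPath H u v h).support =
      if H.Adj u v then [(u, 0), (v, 1), (u, 1), (v, 0)] else [(u, 0), (v, 0)] := by
  unfold mPrimeFillPath
  split_ifs <;> rfl

theorem fst_mem_of_mem_support_mPrimeFillPath {V : Type u} {H : SimpleGraph V}
    [DecidableRel H.Adj] {u v : V} {h : u ≠ v} {w : V × Fin 2}
    (hw : w ∈ (mPrimeFillPath H u v h).support) : w.1 ∈ s(u, v) := by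
  rw [support_mPrimeFillPath] at hw
  split_ifs at hw <;> simp at hw <;> rw [Sym2.mem_iff] <;> grind

/-- For every graph `H` on `V`, the graph `mPrimeFill H` has a scheme of the complete graph. -/
def mPrimeFillScheme {V : Type u} (H : SimpleGraph V) [DecidableRel H.Adj] :
    HScheme (completeGraph V) (mPrimeFill H) (mPrimeRoot V) where
  path u v h := mPrimeFillPath H u v h
  path_symm u v h := by
    unfold mPrimeFillPath
    by_cases hH : H.Adj u v
    · rw [dif_pos hH, dif_pos hH.symm]
      rfl
    · have hH' : ¬ H.Adj v u := fun k => hH k.symm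
      rw [dif_neg hH, dif_neg hH']
      rfl
  isPath u v h := by
    have h' : u ≠ v := h
    refine (Walk.isPath_def (mPrimeFillPath H u v h)).2 ?_
    rw [support_mPrimeFillPath]
    split_ifs <;> simp [h', h'.symm]
  inter_eq u v h := by
    have hr : ∀ v, mPrimeRoot V v = (v, 0) := fun _ => rfl
    ext ⟨x, i⟩
    refine (and_congr_left' (iff_of_eq
      (congrArg ((x, i) ∈ ·) (support_mPrimeFillPath H u v h)))).trans ?_
    split_ifs <;> simp [hr] <;> grind
  common_endpoint S _ hS := by
    rintro ⟨w, hw⟩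
    refine ⟨w.1, fun e he => ?_⟩
    induction e with
    | _ u v => exact fst_mem_of_mem_support_mPrimeFillPath (hw u v (hS he) he)

/-! ### Sets of natural numbers as bit masks -/

/-- The values `f 0, …, f (n - 1)`, stored in a list. -/
def tabulate (n : ℕ) (f : ℕ → ℕ) : ℕ → ℕ :=
  let l := (List.range n).map f
  fun i => l.getD i 0

theorem tabulate_of_lt {n : ℕ} {f : ℕ → ℕ} {i : ℕ} (h : i < n) : tabulate n f i = f i := by
  simp [tabulate, List.getD, h]

/-- The neighbourhood of a set of vertices, where `A` lists the neighbourhoods of the vertices. -/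
def nbhdMask : List ℕ → ℕ → ℕ
  | [], _ => 0
  | a :: A, r => if r.testBit 0 then a ||| nbhdMask A (r / 2) else nbhdMask A (r / 2)

theorem testBit_nbhdMask {A : List ℕ} {r i j : ℕ} (hi : r.testBit i)
    (hj : (A.getD i 0).testBit j) : (nbhdMask A r).testBit j := by
  induction A generalizing r i with
  | nil => simp at hj
  | cons a A ih =>
    cases i with
    | zero => simp_all [nbhdMask]
    | succ i =>
      have := ih (r := r / 2) (i := i) (by simpa [Nat.testBit_succ] using hi) (by simpa using hj)
      unfold nbhdMask
      split_ifs <;> simp [this]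

/-- A set containing the component of `r` in the subgraph induced by `U`. -/
def componentMask (A : List ℕ) (U : ℕ) : ℕ → ℕ → ℕ
  -- Running out of fuel yields all of `U`, which is still a superset of the component.
  | 0, _ => U
  | k + 1, r =>
    let s := r ||| (nbhdMask A r &&& U)
    if s = r then r else componentMask A U k s

/-- Once the iteration is stable, the mask is closed under adjacency in `C`, so membership
propagates along walks of `C` from `a`. -/
theorem testBit_componentMask {W : Type*} {G : SimpleGraph W} {e : W → ℕ} {A : List ℕ}
    (hA : ∀ x y, G.Adj x y → (A.getD (e x) 0).testBit (e y)) {C : G.Subgraph} (hC : C.Connected)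
    {U : ℕ} (hU : ∀ x ∈ C.verts, U.testBit (e x)) {a : W} (ha : a ∈ C.verts) (k : ℕ) {r : ℕ}
    (hr : r.testBit (e a)) {x : W} (hx : x ∈ C.verts) :
    (componentMask A U k r).testBit (e x) := by
  induction k generalizing r with
  | zero => exact hU x hx
  | succ k ih =>
    unfold componentMask
    simp only
    split_ifs with hs
    · obtain ⟨p⟩ := hC.coe.preconnected ⟨a, ha⟩ ⟨x, hx⟩
      have key : ∀ (y z : C.verts), C.coe.Walk y z → r.testBit (e y) → r.testBit (e z) := by
        intro y z p hy
        induction p with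
        | nil => exact hy
        | @cons y w z hadj _ ih =>
          refine ih ?_
          rw [← hs, Nat.testBit_or, Nat.testBit_and,
            testBit_nbhdMask hy (hA _ _ (C.adj_sub hadj)), hU _ w.2]
          simp
      exact key _ _ p hr
    · exact ih (by simp [hr])

/-! ### Exhaustive search for a rooted minor -/

/-- Whether there are no rooted bags `C v ⊆ U v` (`v < n`), with neighbourhoods listed in `A`, such
that the bags of each pair in `E` are adjacent and no vertex in `xs` lies in two of the bags. -/
def refuteMinor (n : ℕ) (A : List ℕ) (E : List (ℕ × ℕ)) : List ℕ → (ℕ → ℕ) → Bool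
  | xs, U =>
    let T := tabulate n fun v => componentMask A (U v) A.length (2 ^ v)
    E.any (fun p => nbhdMask A (T p.1) &&& T p.2 == 0) ||
      match xs with
      | [] => false
      | x :: xs => (List.range n).all fun v =>
          -- Only bag `v` may keep `x`; the `xor` clears bit `x` in all others.
          refuteMinor n A E xs fun w => if w = v then T w else T w ^^^ (T w &&& 2 ^ x)

/-- An actual minor survives along one branch of the search: the invariant is that `U v` contains `C
v`, and each branching vertex is given to the bag that owns it. -/
theorem refuteMinor_eq_false {W : Type*} {G : SimpleGraph W} {e : W → ℕ} {n : ℕ} {A : List ℕ}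
    {E : List (ℕ × ℕ)} (hn : 0 < n)
    (hA : ∀ x y, G.Adj x y → (A.getD (e x) 0).testBit (e y)) {C : ℕ → G.Subgraph}
    (hC : ∀ v < n, (C v).Connected) {r : ℕ → W} (hr : ∀ v < n, r v ∈ (C v).verts)
    (her : ∀ v < n, e (r v) = v) (he : Function.Injective e)
    (hdisj : ∀ u < n, ∀ v < n, u ≠ v → Disjoint (C u).verts (C v).verts)
    (hE : ∀ p ∈ E, p.1 < n ∧ p.2 < n ∧ ∃ x ∈ (C p.1).verts, ∃ y ∈ (C p.2).verts, G.Adj x y)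
    (xs : List ℕ) {U : ℕ → ℕ} (hU : ∀ v < n, ∀ x ∈ (C v).verts, (U v).testBit (e x)) :
    refuteMinor n A E xs U = false := by
  have hT : ∀ U : ℕ → ℕ, (∀ v < n, ∀ x ∈ (C v).verts, (U v).testBit (e x)) →
      ∀ v < n, ∀ x ∈ (C v).verts,
        (tabulate n (fun v => componentMask A (U v) A.length (2 ^ v)) v).testBit (e x) := by
    intro U hU v hv x hx
    rw [tabulate_of_lt hv]
    exact testBit_componentMask hA (hC v hv) (hU v hv) (hr v hv) _ (by simp [her v hv]) hx
  have hany : ∀ T : ℕ → ℕ, (∀ v < n, ∀ x ∈ (C v).verts, (T v).testBit (e x)) →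
      E.any (fun p => nbhdMask A (T p.1) &&& T p.2 == 0) = false := by
    intro T hT
    rw [List.any_eq_false]
    intro p hp h0
    obtain ⟨h₁, h₂, x, hx, y, hy, hxy⟩ := hE p hp
    have h := congrArg (fun m => m.testBit (e y)) (eq_of_beq h0)
    simp [testBit_nbhdMask (hT _ h₁ x hx) (hA x y hxy), hT _ h₂ y hy] at h
  induction xs generalizing U with
  | nil =>
    unfold refuteMinor
    simp only [hany _ (hT U hU), Bool.false_or]
  | cons a xs ih =>
    unfold refuteMinor
    simp only [hany _ (hT U hU), Bool.false_or]
    rw [List.all_eq_false]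
    obtain ⟨v, hv, hav⟩ : ∃ v < n, ∀ w < n, w ≠ v → ∀ x ∈ (C w).verts, e x ≠ a := by
      by_cases h : ∃ v < n, ∃ x ∈ (C v).verts, e x = a
      · obtain ⟨v, hv, x, hx, hxa⟩ := h
        refine ⟨v, hv, fun w hw hwv y hy hya => ?_⟩
        rw [← hxa] at hya
        exact Set.disjoint_left.1 (hdisj w hw v hv hwv) hy (he hya ▸ hx)
      · push Not at h
        -- A vertex in no bag may be given to any of them.
        exact ⟨0, hn, fun w hw _ => h w hw⟩
    refine ⟨v, List.mem_range.2 hv, ?_⟩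
    rw [Bool.not_eq_true]
    refine ih fun w hw x hx => ?_
    split_ifs with hwv
    · exact hT U hU w hw x hx
    · rw [Nat.testBit_xor, Nat.testBit_and, hT U hU w hw x hx,
        Nat.testBit_two_pow_of_ne (hav w hw hwv x hx).symm]
      rfl

/-! ### The theta graph -/

/-- The graph consisting of three paths of lengths `2`, `3` and `3` between `0` and `1`. -/
def thetaGraph : SimpleGraph (Fin 7) where
  Adj u v := s(u, v) ∈ [s(0, 5), s(5, 1), s(0, 2), s(2, 3), s(3, 1), s(0, 6), s(6, 4), s(4, 1)]
  symm := ⟨fun u v h => by rwa [Sym2.eq_swap (a := v)]⟩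
  loopless := ⟨by decide⟩

instance : DecidableRel thetaGraph.Adj := fun _ _ => by
  unfold thetaGraph
  infer_instance

/-- The edges of `thetaGraph`. -/
def thetaEdges : List (ℕ × ℕ) :=
  [(0, 5), (5, 1), (0, 2), (2, 3), (3, 1), (0, 6), (6, 4), (4, 1)]

/-- The neighbourhoods of the vertices of `mPrimeFill thetaGraph`, where `(v, i)` has the
number `v + 7 * i`. -/
def thetaMasks : List ℕ :=
  [12826, 7237, 1266, 881, 8493, 476, 2222, 12900, 7224, 1161, 774, 8514, 387, 2193]

theorem refuteMinor_theta :
    refuteMinor 7 thetaMasks thetaEdges [7, 8, 9, 10, 11, 12, 13]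
      (fun v => 2 ^ v ||| 127 <<< 7) = true := by
  decide +kernel

theorem not_hasRootedMinor_mPrimeFill_thetaGraph :
    ¬ HasRootedMinor (completeGraph (Fin 7)) (mPrimeFill thetaGraph) (mPrimeRoot (Fin 7)) := by
  rintro ⟨C, hC, hdisj, hr, hE⟩
  let e : Fin 7 × Fin 2 → ℕ := fun x => x.1 + 7 * x.2
  have he : Function.Injective e := by
    rintro ⟨u, i⟩ ⟨v, j⟩ h
    simp only [e] at h
    ext <;> simp only <;> omega
  have hA : ∀ x y, (mPrimeFill thetaGraph).Adj x y → (thetaMasks.getD (e x) 0).testBit (e y) := by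
    decide
  have hE' : ∀ p ∈ thetaEdges, p.1 < 7 ∧ p.2 < 7 ∧ p.1 ≠ p.2 := by decide
  have h := refuteMinor_eq_false (n := 7) (C := fun v => C (Fin.ofNat 7 v))
    (r := fun v => (Fin.ofNat 7 v, 0)) (E := thetaEdges) (by norm_num) hA (fun v _ => hC _)
    (fun v _ => hr _) (fun v hv => by simp [e, Nat.mod_eq_of_lt hv]) he
    (fun u hu v hv huv => hdisj _ _ fun h => huv ?_) (fun p hp => ?_)
    [7, 8, 9, 10, 11, 12, 13] (U := fun v => 2 ^ v ||| 127 <<< 7) ?_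
  · exact absurd (refuteMinor_theta.symm.trans h) (by decide)
  · simpa [Fin.ext_iff, Nat.mod_eq_of_lt hu, Nat.mod_eq_of_lt hv] using h
  · obtain ⟨h₁, h₂, hne⟩ := hE' p hp
    refine ⟨h₁, h₂, hE _ _ fun h => hne ?_⟩
    simpa [Fin.ext_iff, Nat.mod_eq_of_lt h₁, Nat.mod_eq_of_lt h₂] using h
  -- The initial mask of `v` is its own root and all non-roots (bits 7 to 13), as the other roots
  -- lie in other bags.
  · rintro v hv ⟨w, i⟩ hx
    have hw : i = 0 → w = Fin.ofNat 7 v := by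
      rintro rfl
      by_contra hne
      exact Set.disjoint_left.1 (hdisj _ _ hne) (hr w) hx
    have hmask : ∀ v w : Fin 7, ∀ i : Fin 2, (i = 0 → w = v) →
        (2 ^ v.val ||| 127 <<< 7).testBit (e (w, i)) := by decide
    simpa [Nat.mod_eq_of_lt hv] using hmask (Fin.ofNat 7 v) w i hw

theorem mainTheorem10 :
    IsMPrimeContractible (SimpleGraph.completeGraph (Fin 7)) ∧
      ¬ IsContractible (SimpleGraph.completeGraph (Fin 7)) :=
  ⟨isMPrimeContractible_completeGraph_fin_seven, fun h =>
    not_hasRootedMinor_mPrimeFill_thetaGraph (h _ _ _ ⟨mPrimeFillScheme thetaGraph⟩)⟩
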